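/- Let $\mathcal A$ be a continuous inverse algebra (CIA), i.e. a Hausdorff locally convex unital associative complex topological algebra whose unit group $\mathcal A^\times$ is open and whose inversion $a\mapsto a^{-1}$ is continuous on $\mathcal A^\times$; the open set $\mathcal A^\times\subseteq\mathcal A$ is regarded as a manifold modeled on $\mathcal A$. Smooth means $C^\infty$ over $\mathbb R$ in the sense of Michal–Bastiani. Let $\mathcal P(\mathcal A)=\{p\in\mathcal A\mid p^2=p\}$, with the topology induced from $\mathcal A$. For $p,q\in\mathcal P(\mathcal A)$ write $p\le q$ if $qp=p$, and $p\sim q$ if $pq=q$ and $qp=p$ (equivalently $p\mathcal A=q\mathcal A$). Let $\mathrm{Gr}(\mathcal A)=\mathcal P(\mathcal A)/\!\sim$, with the quotient topology; the class of $p$ is identified with the right ideal $p\mathcal A$. For $n\ge 1$ let $\mathcal P_n(\mathcal A)=\{(p_1,\dots,p_n)\in\mathcal P(\mathcal A)^n\mid p_1\le\dots\le p_n\}$ and $\mathrm{Fl}_{\mathcal A}(n)=\mathcal P_n(\mathcal A)/\!\sim$, where $(p_j)_j\sim(q_j)_j$ means $p_j\sim q_j$ for all $j$. The group $\mathcal A^\times$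 acts on $\mathrm{Fl}_{\mathcal A}(n)$ by $g.[(p_1,\dots,p_n)]=[(gp_1g^{-1},\dots,gp_ng^{-1})]$, i.e. $(p_j\mathcal A)_j\mapsto(gp_j\mathcal A)_j$. For $\delta=(p_1,\dots,p_n)\in\mathcal P_n(\mathcal A)$ let $\mathrm{Fl}_{\mathcal A}([\delta])$ be the orbit of $[\delta]$, and let $\Delta(\delta)=\{x\in\mathcal A\mid xp_k=p_kxp_k \text{ for } k=1,\dots,n\}$, a unital subalgebra of $\mathcal A$ with unit group $\Delta(\delta)^\times$. **Theorem.** Let $\mathcal A$ be a CIA and $n\ge1$. 1. For every $\delta\in\mathcal P_n(\mathcal A)$ the map $g\Delta(\delta)^\times\mapsto g.[\delta]$ is a well-defined bijection $\mathcal A^\times/\Delta(\delta)^\times\to\mathrm{Fl}_{\mathcal A}([\delta])$. Equipped with the topology which makes this bijection a homeomorphism (for the quotient topology on $\mathcal A^\times/\Delta(\delta)^\times$), $\mathrm{Fl}_{\mathcal A}([\delta])$ has a structure of a (Hausdorff) smooth manifold modeled on a Hausdorff locally convex space such that the transitive action $\mathcal A^\times\times\mathrm{Fl}_{\mathcal A}([\delta])\to\mathrm{Fl}_{\mathcal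 A}([\delta])$, $(g,X)\mapsto g.X$, is smooth, and the orbit map $\mathcal A^\times\to\mathrm{Fl}_{\mathcal A}([\delta])$, $g\mapsto g.[\delta]$, is smooth and open. 2. The natural map $\mathrm{Fl}_{\mathcal A}(n)\to\mathrm{Gr}(\mathcal A)^n$, $[(p_1,\dots,p_n)]\mapsto(p_1\mathcal A,\dots,p_n\mathcal A)$, is injective, and it is continuous when $\mathrm{Fl}_{\mathcal A}(n)$ is given the topology of the disjoint union of its orbits $\mathrm{Fl}_{\mathcal A}([\delta])$, each with its manifold topology from 1, and $\mathrm{Gr}(\mathcal A)^n$ the product topology. -/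

import Mathlib

open Topology Filter

universe u v

/-! ### Smooth maps between locally convex spaces

`C^k`-maps in the sense of Michal and Bastiani (Keller's `C^k_c`-maps), over the field `ℝ`. -/

namespace LCManifold

/-- `IsCk k f U`: the map `f` is of class `C^k` on the (open) set `U`. It is `C^0` if it is continuous,
and `C^(k+1)` if it is continuous, all directional derivatives
`df (x, h) = lim_{t → 0} (f (x + t h) - f x) / t` with `x ∈ U` exist,
and `df` is of class `C^k` on `U × E`. -/
def IsCk {F : Type v} [AddCommGroup F] [Module ℝ F] [TopologicalSpace F] :
    ℕ → ∀ {E : Type u} [AddCommGroup E] [Module ℝ E] [TopologicalSpace E],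
      (E → F) → Set E → Prop
  | 0, _, _, _, _, f, U => ContinuousOn f U
  | k + 1, E, _, _, _, f, U => ContinuousOn f U ∧ ∃ df : E × E → F,
      (∀ x ∈ U, ∀ h : E,
        Tendsto (fun t : ℝ => t⁻¹ • (f (x + t • h) - f x)) (𝓝[≠] 0) (𝓝 (df (x, h)))) ∧
      IsCk k df (U ×ˢ (Set.univ : Set E))

/-- `f` is smooth on the open set `U`. -/
def IsSmoothOn {E : Type u} {F : Type v} [AddCommGroup E] [Module ℝ E] [TopologicalSpace E]
    [AddCommGroup F] [Module ℝ F] [TopologicalSpace F] (f : E → F) (U : Set E) : Prop :=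
  IsOpen U ∧ ∀ k : ℕ, IsCk k f U

/-- The charted space `M` is a smooth manifold modeled on `E`: it is Hausdorff and all
coordinate changes are smooth. -/
structure IsSmoothManifold (E : Type u) [AddCommGroup E] [Module ℝ E] [TopologicalSpace E]
    (M : Type v) [TopologicalSpace M] [ChartedSpace E M] : Prop where
  t2 : T2Space M
  smooth_coord_change : ∀ e ∈ atlas E M, ∀ e' ∈ atlas E M,
    IsSmoothOn (e' ∘ e.symm) (e.symm.trans e').source

/-- Smooth maps between smooth manifolds: continuous maps which are smooth in all charts. -/
def IsSmoothMap {M N : Type*} (E F : Type*)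
    [AddCommGroup E] [Module ℝ E] [TopologicalSpace E]
    [AddCommGroup F] [Module ℝ F] [TopologicalSpace F]
    [TopologicalSpace M] [ChartedSpace E M] [TopologicalSpace N] [ChartedSpace F N]
    (f : M → N) : Prop :=
  Continuous f ∧ ∀ e ∈ atlas E M, ∀ e' ∈ atlas F N,
    IsSmoothOn (e' ∘ f ∘ e.symm) (e.target ∩ e.symm ⁻¹' (f ⁻¹' e'.source))

/-- The product of two manifolds, modeled on the product of the model spaces: its atlas consists
of the products of the charts. -/
instance prodCharted (E F M N : Type*) [TopologicalSpace E] [TopologicalSpace F]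
    [TopologicalSpace M] [ChartedSpace E M] [TopologicalSpace N] [ChartedSpace F N] :
    ChartedSpace (E × F) (M × N) :=
  prodChartedSpace E M F N

end LCManifold

/-! ### Continuous inverse algebras -/

/-- A continuous inverse algebra: a Hausdorff locally convex unital associative complex topological
algebra whose unit group is open and whose inversion is continuous on the unit group. -/
class ContinuousInverseAlgebra (A : Type u) [Ring A] [Algebra ℂ A] [TopologicalSpace A] : Prop
    extends IsTopologicalRing A, ContinuousSMul ℂ A, LocallyConvexSpace ℝ A, T2Space A where
  isOpen_units : IsOpen {a : A | IsUnit a}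
  continuousOn_inverse : ContinuousOn (Ring.inverse : A → A) {a : A | IsUnit a}

namespace ContinuousInverseAlgebra

variable (A : Type u) [Ring A] [Algebra ℂ A] [TopologicalSpace A] [ContinuousInverseAlgebra A]

/-- The unit group is an open subset of the algebra. -/
theorem isOpenEmbedding_val : IsOpenEmbedding (Units.val : Aˣ → A) := by
  have hr : Set.range (Units.val : Aˣ → A) = {a : A | IsUnit a} := rfl
  refine ⟨Units.isEmbedding_val_mk' (f := Ring.inverse) ?_ ?_, ?_⟩
  · exact continuousOn_inverse
  · intro u
    exact Ring.inverse_unit u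
  · rw [hr]
    exact isOpen_units

/-- The unit group as a manifold modeled on `A`, with the inclusion into `A` as its only chart. -/
noncomputable instance unitsCharted : ChartedSpace A Aˣ :=
  (isOpenEmbedding_val A).singletonChartedSpace

end ContinuousInverseAlgebra

/-! ### Grassmannians and flags -/

namespace FlagManifold

variable (A : Type u) [Ring A]

/-- The set `P(A)` of idempotents; it carries the topology induced from `A`. -/
abbrev Idem : Type u := {p : A // IsIdempotentElem p}

/-- The set `P_n(A)` of `n`-tuples of idempotents with `p_1 ≤ ⋯ ≤ p_n`, where `p ≤ q` means
`q p = p`. -/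
abbrev FlagTuple (n : ℕ) : Type u :=
  {p : Fin n → Idem A // ∀ i j, i ≤ j → (p j).1 * (p i).1 = (p i).1}

/-- `p ∼ q` if and only if `p q = q` and `q p = p`, that is, `p A = q A`. -/
instance idemSetoid : Setoid (Idem A) where
  r p q := p.1 * q.1 = q.1 ∧ q.1 * p.1 = p.1
  iseqv :=
    { refl := fun p => ⟨p.2, p.2⟩
      symm := fun h => ⟨h.2, h.1⟩
      trans := by
        rintro p q r ⟨h1, h2⟩ ⟨h3, h4⟩
        constructor
        · rw [← h3, ← mul_assoc, h1]
        · rw [← h2, ← mul_assoc, h4] }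

/-- `(p_1, …, p_n) ∼ (q_1, …, q_n)` if and only if `p_j ∼ q_j` for all `j`. -/
instance flagSetoid (n : ℕ) : Setoid (FlagTuple A n) where
  r p q := ∀ j, p.1 j ≈ q.1 j
  iseqv :=
    { refl := fun p j => Setoid.refl (p.1 j)
      symm := fun h j => Setoid.symm (h j)
      trans := fun h h' j => Setoid.trans (h j) (h' j) }

/-- The Grassmannian `Gr(A) = P(A)/∼`. -/
def Gr : Type u := Quotient (idemSetoid A)

/-- The set of `n`-flags `Fl_A(n) = P_n(A)/∼`. -/
def Fl (n : ℕ) : Type u := Quotient (flagSetoid A n)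

variable {A}

/-- The flag `[(p_1, …, p_n)]`. -/
def flag {n : ℕ} (δ : FlagTuple A n) : Fl A n := Quotient.mk (flagSetoid A n) δ

/-- The natural map `Fl_A(n) → Gr(A)^n`, `[(p_1, …, p_n)] ↦ (p_1 A, …, p_n A)`. -/
def toGr {n : ℕ} : Fl A n → Fin n → Gr A :=
  Quotient.lift (fun (δ : FlagTuple A n) (j : Fin n) => Quotient.mk (idemSetoid A) (δ.1 j))
    (fun _ _ h => funext fun j => Quotient.sound (h j))

/-- The idempotent `g p g⁻¹`. -/
def conjIdem (g : Aˣ) (p : Idem A) : Idem A :=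
  ⟨g * p.1 * ↑g⁻¹, by
    have h : p.1 * p.1 = p.1 := p.2
    simp only [IsIdempotentElem, mul_assoc, Units.inv_mul_cancel_left]
    rw [← mul_assoc p.1 p.1, h]⟩

theorem conj_mul (g : Aˣ) (a b : A) :
    ((g : A) * a * ↑g⁻¹) * ((g : A) * b * ↑g⁻¹) = (g : A) * (a * b) * ↑g⁻¹ := by
  simp only [mul_assoc, Units.inv_mul_cancel_left]

/-- The tuple `(g p_1 g⁻¹, …, g p_n g⁻¹)`. -/
def conjTuple {n : ℕ} (g : Aˣ) (δ : FlagTuple A n) : FlagTuple A n :=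
  ⟨fun j => conjIdem g (δ.1 j), fun i j hij => by
    simp only [conjIdem, conj_mul, δ.2 i j hij]⟩

/-- The action of `A^×` on `Fl_A(n)`, `g • [(p_1, …, p_n)] = [(g p_1 g⁻¹, …, g p_n g⁻¹)]`;
in terms of right ideals `(p_1 A, …, p_n A) ↦ (g p_1 A, …, g p_n A)`. -/
instance flagAction (n : ℕ) : MulAction Aˣ (Fl A n) where
  smul g := Quotient.map (conjTuple g) (fun δ δ' h j => by
    obtain ⟨h1, h2⟩ := h j
    exact ⟨by simp only [conjTuple, conjIdem, conj_mul, h1],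
      by simp only [conjTuple, conjIdem, conj_mul, h2]⟩)
  one_smul X := by
    induction X using Quotient.inductionOn with
    | h δ =>
      refine congrArg (Quotient.mk _) ?_
      refine Subtype.ext (funext fun j => Subtype.ext ?_)
      simp [conjTuple, conjIdem]
  mul_smul g h X := by
    induction X using Quotient.inductionOn with
    | h δ =>
      refine congrArg (Quotient.mk _) ?_
      refine Subtype.ext (funext fun j => Subtype.ext ?_)
      simp [conjTuple, conjIdem, mul_assoc]

/-- The algebra `Δ(δ) = {x ∈ A | x p_k = p_k x p_k for all k}`. -/
def upper [Algebra ℂ A] {n : ℕ} (δ : FlagTuple A n) : Subalgebra ℂ A where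
  carrier := {x | ∀ k, x * (δ.1 k).1 = (δ.1 k).1 * x * (δ.1 k).1}
  mul_mem' := by
    intro x y hx hy k
    have h1 := hx k
    have h2 := hy k
    calc x * y * (δ.1 k).1 = x * (δ.1 k).1 * (y * (δ.1 k).1) := by
          rw [mul_assoc x y, mul_assoc x (δ.1 k).1, ← mul_assoc (δ.1 k).1 y, ← h2]
      _ = (δ.1 k).1 * (x * y) * (δ.1 k).1 := by
          rw [h1, mul_assoc _ (δ.1 k).1 (y * _), ← mul_assoc (δ.1 k).1 y, ← h2]
          simp only [mul_assoc]
  add_mem' := by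
    intro x y hx hy k
    rw [add_mul, mul_add, add_mul, ← hx k, ← hy k]
  algebraMap_mem' := by
    intro c k
    rw [← Algebra.commutes c (δ.1 k).1, mul_assoc, (δ.1 k).2.eq]

/-- The group `Δ(δ)^×`, as a subgroup of `A^×`. -/
def upperUnits [Algebra ℂ A] {n : ℕ} (δ : FlagTuple A n) : Subgroup Aˣ :=
  (upper δ).toSubmonoid.units

/-- The orbit map `A^× → Fl_A(X)`, `g ↦ g • X`, onto the flag manifold of `X`. -/
def orbitMap {n : ℕ} (X : Fl A n) (g : Aˣ) : MulAction.orbit Aˣ X :=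
  ⟨g • X, MulAction.mem_orbit X g⟩

variable [TopologicalSpace A]

/-- `Gr(A)` carries the quotient topology. -/
instance : TopologicalSpace (Gr A) := instTopologicalSpaceQuotient

/-- `Fl_A(n)` carries the topology of the disjoint union of its flag manifolds, that is, of the
`A^×`-orbits, where each orbit is equipped with the quotient topology of `A^×`. Explicitly, `U` is
open if and only if `{g | g • X ∈ U}` is open in `A^×` for all `X`. -/
instance (n : ℕ) : TopologicalSpace (Fl A n) :=
  ⨆ X : Fl A n, TopologicalSpace.coinduced (fun g : Aˣ => g • X) inferInstance

end FlagManifold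

/-! The proof is a block version of the LU factorization. Up to `∼`, a flag is represented by pairwise
commuting idempotents `p_1 ≤ ⋯ ≤ p_n` (`exists_isCommutingChain`); put `p_0 = 0` and `p_{n+1} = 1`.
Then `Δ(δ)` is the algebra of block upper triangular elements, and it is complemented in `A` by the
space `E` of strictly lower triangular elements (`strictLower`), which are nilpotent. The set `Ω` of
all `g ∈ A` whose corners `p_k g p_k` are invertible in `p_k A p_k` is open (`bigCell`). For `g ∈ Ω`,
the right ideal `g p_k A` is a complement of `(1 - p_k) A`, and the projection onto it is given by an
explicit formula `q_k(g)` involving only multiplication and inversion (`cornerProj`). It depends on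
`g` only through the flag of `g`. The element `∑ k, q_{k+1}(g) (p_{k+1} - p_k)` has the form `1 + x`
with `x ∈ E`, and it defines the same flag as `g` (`cornerProj_one_add_lowerCoord`); conversely every
`x ∈ E` is recovered from `1 + x` in this way (`lowerCoord_one_add`).

Hence `x ↦ h (1 + x).[δ]`, for `h ∈ A^×`, parametrizes an open piece of the orbit by all of `E`, and
the inverses of these maps form an atlas (`flagChart`). In these charts the coordinate changes, the
action and the orbit map are compositions of multiplications with the map `g ↦ x`, so they are smooth
once multiplication and inversion are. The topological assertions follow from the openness
of the orbit map and the closedness of the stabilizer `Δ(δ)^×`.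

The chain rule for Michal-Bastiani maps needs a mean value theorem. It is avoided by working with
difference quotients (`IsSlopeCk`): for these the chain rule is purely algebraic, and they
give Michal-Bastiani smoothness by setting `t = 0`. -/

universe w

/-! ### Differentiability by difference quotients -/

namespace LCManifold

/-- `IsSlopeCk k f U`: the map `f` is `C^k` on `U` in the sense of Bertram, Glöckner and Neeb: the
difference quotient `(f (x + t h) - f x) / t` extends to a map of `(x, h, t)` which is defined and
of class `C^(k-1)` wherever `x` and `x + t h` lie in `U`, also for `t = 0`. The values of the
extension `f₁` outside this set are irrelevant. -/
def IsSlopeCk {F : Type v} [AddCommGroup F] [Module ℝ F] [TopologicalSpace F] :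
    ℕ → ∀ {E : Type u} [AddCommGroup E] [Module ℝ E] [TopologicalSpace E],
      (E → F) → Set E → Prop
  | 0, _, _, _, _, f, U => ContinuousOn f U
  | k + 1, E, _, _, _, f, U => ContinuousOn f U ∧ ∃ f₁ : E × E × ℝ → F,
      (∀ x ∈ U, ∀ (h : E) (t : ℝ), x + t • h ∈ U → f (x + t • h) - f x = t • f₁ (x, h, t)) ∧
      IsSlopeCk k f₁ {y : E × E × ℝ | y.1 ∈ U ∧ y.1 + y.2.2 • y.2.1 ∈ U}

namespace IsSlopeCk

section

variable {E : Type u} [AddCommGroup E] [Module ℝ E] [TopologicalSpace E]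
  {F : Type v} [AddCommGroup F] [Module ℝ F] [TopologicalSpace F]
  {G : Type w} [AddCommGroup G] [Module ℝ G] [TopologicalSpace G]

theorem continuousOn {k : ℕ} {f : E → F} {U : Set E} (hf : IsSlopeCk k f U) :
    ContinuousOn f U := by
  cases k with
  | zero => exact hf
  | succ k => exact hf.1

theorem mono {k : ℕ} {f : E → F} {U V : Set E} (hf : IsSlopeCk k f V) (hUV : U ⊆ V) :
    IsSlopeCk k f U := by
  induction k generalizing E with
  | zero => exact ContinuousOn.mono hf hUV
  | succ k ih =>
    obtain ⟨hc, f₁, h₁, h₂⟩ := hf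
    exact ⟨hc.mono hUV, f₁, fun x hx h t hxt => h₁ x (hUV hx) h t (hUV hxt),
      ih h₂ fun y hy => ⟨hUV hy.1, hUV hy.2⟩⟩

theorem congr {k : ℕ} {f g : E → F} {U : Set E} (hf : IsSlopeCk k f U)
    (hfg : ∀ x ∈ U, g x = f x) : IsSlopeCk k g U := by
  cases k with
  | zero => exact ContinuousOn.congr hf hfg
  | succ k =>
    obtain ⟨hc, f₁, h₁, h₂⟩ := hf
    refine ⟨hc.congr hfg, f₁, fun x hx h t hxt => ?_, h₂⟩
    rw [hfg _ hx, hfg _ hxt, h₁ x hx h t hxt]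

theorem of_succ {k : ℕ} {f : E → F} {U : Set E} (hf : IsSlopeCk (k + 1) f U) :
    IsSlopeCk k f U := by
  induction k generalizing E with
  | zero => exact hf.1
  | succ k ih =>
    obtain ⟨hc, f₁, h₁, h₂⟩ := hf
    exact ⟨hc, f₁, h₁, ih h₂⟩

theorem const (k : ℕ) (c : F) (U : Set E) : IsSlopeCk k (fun _ : E => c) U := by
  induction k generalizing E c with
  | zero => exact continuousOn_const
  | succ k ih => exact ⟨continuousOn_const, fun _ => 0, by simp, ih 0 _⟩

theorem clm (k : ℕ) (L : E →L[ℝ] F) (U : Set E) : IsSlopeCk k (fun x => L x) U := by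
  induction k generalizing E with
  | zero => exact L.continuous.continuousOn
  | succ k ih =>
    refine ⟨L.continuous.continuousOn, fun y => L y.2.1, fun x _ h t _ => ?_, ?_⟩
    · simp
    · exact ih (L.comp ((ContinuousLinearMap.fst ℝ E ℝ).comp
        (ContinuousLinearMap.snd ℝ E (E × ℝ)))) _

theorem clm_comp {k : ℕ} {f : E → F} {U : Set E} (L : F →L[ℝ] G) (hf : IsSlopeCk k f U) :
    IsSlopeCk k (fun x => L (f x)) U := by
  induction k generalizing E with
  | zero => exact L.continuous.comp_continuousOn hf
  | succ k ih =>
    obtain ⟨hc, f₁, h₁, h₂⟩ := hf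
    refine ⟨L.continuous.comp_continuousOn hc, fun y => L (f₁ y), fun x hx h t hxt => ?_, ih h₂⟩
    rw [← map_sub, h₁ x hx h t hxt, map_smul]

theorem comp_clm {k : ℕ} {f : F → G} {V : Set F} {U : Set E} (hf : IsSlopeCk k f V)
    (L : E →L[ℝ] F) (hUV : Set.MapsTo L U V) : IsSlopeCk k (fun x => f (L x)) U := by
  induction k generalizing E F with
  | zero => exact ContinuousOn.comp hf L.continuous.continuousOn hUV
  | succ k ih =>
    obtain ⟨hc, f₁, h₁, h₂⟩ := hf
    refine ⟨hc.comp L.continuous.continuousOn hUV, fun y => f₁ (L y.1, L y.2.1, y.2.2),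
      fun x hx h t hxt => ?_, ?_⟩
    · have := h₁ (L x) (hUV hx) (L h) t (by simpa using hUV hxt)
      beta_reduce
      rw [map_add, map_smul, this]
    · refine ih h₂ (L.prodMap (L.prodMap (ContinuousLinearMap.id ℝ ℝ))) fun y hy => ?_
      exact ⟨hUV hy.1, by simpa using hUV hy.2⟩

theorem prodMk {k : ℕ} {f : E → F} {g : E → G} {U : Set E} (hf : IsSlopeCk k f U)
    (hg : IsSlopeCk k g U) : IsSlopeCk k (fun x => (f x, g x)) U := by
  induction k generalizing E with
  | zero => exact ContinuousOn.prodMk hf hg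
  | succ k ih =>
    obtain ⟨hc, f₁, h₁, h₂⟩ := hf
    obtain ⟨hc', g₁, h₁', h₂'⟩ := hg
    refine ⟨hc.prodMk hc', fun y => (f₁ y, g₁ y), fun x hx h t hxt => ?_, ih h₂ h₂'⟩
    rw [Prod.mk_sub_mk, h₁ x hx h t hxt, h₁' x hx h t hxt, Prod.smul_mk]

theorem add [ContinuousAdd F] {k : ℕ} {f g : E → F} {U : Set E} (hf : IsSlopeCk k f U)
    (hg : IsSlopeCk k g U) : IsSlopeCk k (fun x => f x + g x) U :=
  clm_comp (ContinuousLinearMap.fst ℝ F F + ContinuousLinearMap.snd ℝ F F) (hf.prodMk hg)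

theorem sum [ContinuousAdd F] {ι : Type*} (s : Finset ι) {k : ℕ} {f : ι → E → F} {U : Set E}
    (hf : ∀ i ∈ s, IsSlopeCk k (f i) U) : IsSlopeCk k (fun x => ∑ i ∈ s, f i x) U := by
  classical
  induction s using Finset.induction_on with
  | empty => simpa using const k (0 : F) U
  | insert i s hi ih =>
    simp only [Finset.sum_insert hi]
    exact (hf i (Finset.mem_insert_self i s)).add
      (ih fun j hj => hf j (Finset.mem_insert_of_mem hj))

/-- The chain rule: the difference quotient of `f ∘ g` at `(x, h, t)` is that of `f` at
`(g x, g₁ (x, h, t), t)`. -/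
theorem comp {k : ℕ} {f : F → G} {g : E → F} {V : Set F} {U : Set E} (hf : IsSlopeCk k f V)
    (hg : IsSlopeCk k g U) (hUV : Set.MapsTo g U V) : IsSlopeCk k (fun x => f (g x)) U := by
  induction k generalizing E F with
  | zero => exact ContinuousOn.comp hf hg hUV
  | succ k ih =>
    have hg' := of_succ hg
    obtain ⟨hc, f₁, h₁, h₂⟩ := hf
    obtain ⟨hc', g₁, h₁', h₂'⟩ := hg
    have key : ∀ x ∈ U, ∀ (h : E) (t : ℝ), x + t • h ∈ U →
        g x + t • g₁ (x, h, t) = g (x + t • h) := fun x hx h t hxt => by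
      rw [← h₁' x hx h t hxt, add_sub_cancel]
    refine ⟨hc.comp hc' hUV, fun y => f₁ (g y.1, g₁ y, y.2.2), fun x hx h t hxt => ?_, ?_⟩
    · rw [← h₁ (g x) (hUV hx) _ t (by rw [key x hx h t hxt]; exact hUV hxt), key x hx h t hxt]
    · refine ih (g := fun y => (g y.1, g₁ y, y.2.2)) h₂ ?_ fun y hy => ?_
      · refine (comp_clm hg' (ContinuousLinearMap.fst ℝ E (E × ℝ)) fun y hy => hy.1).prodMk
          (h₂'.prodMk ?_)
        exact clm k ((ContinuousLinearMap.snd ℝ E ℝ).comp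
          (ContinuousLinearMap.snd ℝ E (E × ℝ))) _
      · obtain ⟨x, h, t⟩ := y
        exact ⟨hUV hy.1, by simpa only [key x hy.1 h t hy.2] using hUV hy.2⟩

theorem smul [ContinuousAdd F] [ContinuousSMul ℝ F] {k : ℕ} {c : E → ℝ} {f : E → F} {U : Set E}
    (hc : IsSlopeCk k c U) (hf : IsSlopeCk k f U) : IsSlopeCk k (fun x => c x • f x) U := by
  induction k generalizing E with
  | zero => exact ContinuousOn.smul hc hf
  | succ k ih =>
    have hc' := of_succ hc
    have hf' := of_succ hf
    obtain ⟨hcc, c₁, hc₁, hc₂⟩ := hc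
    obtain ⟨hfc, f₁, hf₁, hf₂⟩ := hf
    refine ⟨hcc.smul hfc,
      fun y => c y.1 • f₁ y + c₁ y • f y.1 + y.2.2 • c₁ y • f₁ y, fun x hx h t hxt => ?_, ?_⟩
    · beta_reduce
      rw [sub_eq_iff_eq_add.1 (hc₁ x hx h t hxt), sub_eq_iff_eq_add.1 (hf₁ x hx h t hxt)]
      simp only [smul_eq_mul]
      module
    · have hcx := comp_clm hc' (ContinuousLinearMap.fst ℝ E (E × ℝ))
        (U := {y : E × E × ℝ | y.1 ∈ U ∧ y.1 + y.2.2 • y.2.1 ∈ U}) fun y hy => hy.1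
      have hfx := comp_clm hf' (ContinuousLinearMap.fst ℝ E (E × ℝ))
        (U := {y : E × E × ℝ | y.1 ∈ U ∧ y.1 + y.2.2 • y.2.1 ∈ U}) fun y hy => hy.1
      exact ((ih hcx hf₂).add (ih hc₂ hfx)).add (ih (clm k ((ContinuousLinearMap.snd ℝ E ℝ).comp
          (ContinuousLinearMap.snd ℝ E (E × ℝ))) _) (ih hc₂ hf₂))

/-- A map of class `C^k` on an open set in the sense of difference quotients is of class `C^k`
in the sense of Michal and Bastiani: `df (x, h) = f₁ (x, h, 0)`. -/
theorem isCk [ContinuousAdd E] [ContinuousSMul ℝ E] {k : ℕ} {f : E → F} {U : Set E}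
    (hU : IsOpen U) (hf : IsSlopeCk k f U) : IsCk k f U := by
  induction k generalizing E with
  | zero => exact hf
  | succ k ih =>
    obtain ⟨hc, f₁, h₁, h₂⟩ := hf
    refine ⟨hc, fun y => f₁ (y.1, y.2, 0), fun x hx h => ?_, ?_⟩
    · have hev : ∀ᶠ t : ℝ in 𝓝 0, x + t • h ∈ U := by
        have hcont : ContinuousAt (fun t : ℝ => x + t • h) 0 := by fun_prop
        exact hcont.eventually (by simpa using hU.mem_nhds hx)
      have hmem : (x, h, (0 : ℝ)) ∈ {y : E × E × ℝ | y.1 ∈ U ∧ y.1 + y.2.2 • y.2.1 ∈ U} := by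
        simpa using hx
      have hlim : Tendsto (fun t : ℝ => f₁ (x, h, t)) (𝓝[≠] 0) (𝓝 (f₁ (x, h, 0))) := by
        refine (h₂.continuousOn _ hmem).tendsto.comp (tendsto_nhdsWithin_iff.2 ⟨?_, ?_⟩)
        · have hcont : Continuous (fun t : ℝ => (x, h, t)) := by fun_prop
          exact (hcont.tendsto 0).mono_left nhdsWithin_le_nhds
        · filter_upwards [hev.filter_mono nhdsWithin_le_nhds] with t ht
          exact ⟨hx, ht⟩
      refine hlim.congr' ?_
      filter_upwards [hev.filter_mono nhdsWithin_le_nhds, self_mem_nhdsWithin] with t ht ht0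
      rw [h₁ x hx h t ht, inv_smul_smul₀ ht0]
    · refine ih (hU.prod isOpen_univ) ?_
      refine comp_clm h₂ ((ContinuousLinearMap.fst ℝ E E).prod
        ((ContinuousLinearMap.snd ℝ E E).prod 0)) fun y hy => ?_
      simpa using hy.1

theorem isSmoothOn [ContinuousAdd E] [ContinuousSMul ℝ E] {f : E → F} {U : Set E}
    (hU : IsOpen U) (hf : ∀ k, IsSlopeCk k f U) : IsSmoothOn f U :=
  ⟨hU, fun k => (hf k).isCk hU⟩

end

section Algebra

variable {E : Type u} [AddCommGroup E] [Module ℝ E] [TopologicalSpace E]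
  {A : Type v} [Ring A] [Algebra ℝ A] [TopologicalSpace A] [IsTopologicalRing A]
  [ContinuousSMul ℝ A]

theorem mul {k : ℕ} {f g : E → A} {U : Set E} (hf : IsSlopeCk k f U) (hg : IsSlopeCk k g U) :
    IsSlopeCk k (fun x => f x * g x) U := by
  induction k generalizing E with
  | zero => exact ContinuousOn.mul hf hg
  | succ k ih =>
    have hf' := of_succ hf
    have hg' := of_succ hg
    obtain ⟨hfc, f₁, hf₁, hf₂⟩ := hf
    obtain ⟨hgc, g₁, hg₁, hg₂⟩ := hg
    refine ⟨hfc.mul hgc,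
      fun y => f y.1 * g₁ y + f₁ y * g y.1 + y.2.2 • (f₁ y * g₁ y), fun x hx h t hxt => ?_, ?_⟩
    · beta_reduce
      rw [sub_eq_iff_eq_add.1 (hf₁ x hx h t hxt), sub_eq_iff_eq_add.1 (hg₁ x hx h t hxt)]
      simp only [add_mul, mul_add, smul_mul_assoc, mul_smul_comm, smul_add]
      abel
    · have hfx := comp_clm hf' (ContinuousLinearMap.fst ℝ E (E × ℝ))
        (U := {y : E × E × ℝ | y.1 ∈ U ∧ y.1 + y.2.2 • y.2.1 ∈ U}) fun y hy => hy.1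
      have hgx := comp_clm hg' (ContinuousLinearMap.fst ℝ E (E × ℝ))
        (U := {y : E × E × ℝ | y.1 ∈ U ∧ y.1 + y.2.2 • y.2.1 ∈ U}) fun y hy => hy.1
      exact ((ih hfx hg₂).add (ih hf₂ hgx)).add (smul (clm k ((ContinuousLinearMap.snd ℝ E ℝ).comp
          (ContinuousLinearMap.snd ℝ E (E × ℝ))) _) (ih hf₂ hg₂))

/-- Inversion is of class `C^k` because `(x + t h)⁻¹ - x⁻¹ = -t (x + t h)⁻¹ h x⁻¹`. -/
theorem ringInverse (hinv : ContinuousOn (Ring.inverse : A → A) {a : A | IsUnit a}) (k : ℕ) :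
    IsSlopeCk k (Ring.inverse : A → A) {a : A | IsUnit a} := by
  induction k with
  | zero => exact hinv
  | succ k ih =>
    refine ⟨hinv, fun y => -(Ring.inverse (y.1 + y.2.2 • y.2.1) * y.2.1 * Ring.inverse y.1),
      fun x hx h t hxt => ?_, ?_⟩
    · have e1 := Ring.inverse_mul_cancel _ hxt
      have e2 := Ring.mul_inverse_cancel _ hx
      beta_reduce
      set a := Ring.inverse (x + t • h)
      set b := Ring.inverse x
      have e3 : a * x * b + t • (a * h * b) = b := by
        rw [← smul_mul_assoc, ← mul_smul_comm, ← add_mul, ← mul_add, e1, one_mul]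
      rw [mul_assoc, e2, mul_one] at e3
      rw [smul_neg, sub_eq_iff_eq_add, neg_add_eq_sub, eq_sub_iff_add_eq]
      exact e3
    · have hfst := clm k (ContinuousLinearMap.fst ℝ A (A × ℝ))
        {y : A × A × ℝ | y.1 ∈ {a : A | IsUnit a} ∧ y.1 + y.2.2 • y.2.1 ∈ {a : A | IsUnit a}}
      have hh := clm k ((ContinuousLinearMap.fst ℝ A ℝ).comp (ContinuousLinearMap.snd ℝ A (A × ℝ)))
        {y : A × A × ℝ | y.1 ∈ {a : A | IsUnit a} ∧ y.1 + y.2.2 • y.2.1 ∈ {a : A | IsUnit a}}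
      have ht := clm k ((ContinuousLinearMap.snd ℝ A ℝ).comp (ContinuousLinearMap.snd ℝ A (A × ℝ)))
        {y : A × A × ℝ | y.1 ∈ {a : A | IsUnit a} ∧ y.1 + y.2.2 • y.2.1 ∈ {a : A | IsUnit a}}
      have h1 := comp ih (hfst.add (ht.smul hh)) fun y hy => hy.2
      have h2 := comp ih hfst fun y hy => hy.1
      exact clm_comp (-ContinuousLinearMap.id ℝ A) ((h1.mul hh).mul h2)

end Algebra

end IsSlopeCk

end LCManifold

namespace FlagManifold

open LCManifold

/-! ### Projections attached to invertible corners -/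

section Corner

variable {A : Type u} [Ring A] {p g d : A}

/-- The element `p g p + (1 - p)`. It is invertible if and only if the corner `p g p` is invertible
in `p A p`, that is, if `g p A` is a complement of `(1 - p) A` (for invertible `g`). -/
def corner (p g : A) : A := p * g * p + (1 - p)

/-- The projection onto the right ideal `g p A` along `(1 - p) A`, if `corner p g` is invertible. -/
noncomputable def cornerProj (p g : A) : A := g * p * Ring.inverse (corner p g)

theorem mul_corner (hp : p * p = p) : p * corner p g = p * g * p := by
  simp only [corner, mul_add, mul_sub, mul_one, ← mul_assoc, hp, sub_self, add_zero]

theorem corner_mul (hp : p * p = p) : corner p g * p = p * g * p := by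
  simp only [corner, add_mul, sub_mul, one_mul, mul_assoc, hp, sub_self, add_zero]

theorem mul_inverse_corner (hp : p * p = p) (hg : IsUnit (corner p g)) :
    p * Ring.inverse (corner p g) = Ring.inverse (corner p g) * p := by
  have h1 := Ring.inverse_mul_cancel _ hg
  have h2 := Ring.mul_inverse_cancel _ hg
  calc p * Ring.inverse (corner p g)
      = Ring.inverse (corner p g) * (corner p g * p) * Ring.inverse (corner p g) := by
        rw [← mul_assoc, h1, one_mul]
    _ = Ring.inverse (corner p g) * p := by
        rw [corner_mul hp, ← mul_corner hp, mul_assoc, mul_assoc, h2, mul_one]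

theorem cornerProj_mul_self (hp : p * p = p) (hg : IsUnit (corner p g)) :
    cornerProj p g * p = cornerProj p g := by
  rw [cornerProj, mul_assoc, ← mul_inverse_corner hp hg, ← mul_assoc, mul_assoc g, hp]

theorem self_mul_cornerProj (hp : p * p = p) (hg : IsUnit (corner p g)) :
    p * cornerProj p g = p := by
  rw [cornerProj, ← mul_assoc, ← mul_assoc, ← mul_corner hp, mul_assoc,
    Ring.mul_inverse_cancel _ hg, mul_one]

/-- The projection `cornerProj p g` is the identity on `g p A`. -/
theorem cornerProj_mul_mul (hp : p * p = p) (hg : IsUnit (corner p g)) :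
    cornerProj p g * (g * p) = g * p := by
  calc cornerProj p g * (g * p) = cornerProj p g * p * (g * p) := by
        rw [cornerProj_mul_self hp hg]
    _ = g * p * Ring.inverse (corner p g) * (p * g * p) := by
        simp only [cornerProj, mul_assoc]
    _ = g * p := by
        rw [← corner_mul hp, mul_assoc, ← mul_assoc (Ring.inverse _),
          Ring.inverse_mul_cancel _ hg, one_mul, mul_assoc, hp]

/-- A projection along `(1 - p) A` is determined by its image. -/
theorem cornerProj_eq_of_mul_mul (hp : p * p = p) (hg : IsUnit (corner p g))
    (hd : IsUnit (corner p d)) (h : cornerProj p g * (d * p) = d * p) :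
    cornerProj p d = cornerProj p g := by
  have h1 : cornerProj p g * cornerProj p d = cornerProj p d := by
    rw [cornerProj.eq_1 p d, ← mul_assoc, h]
  rw [← h1, ← cornerProj_mul_self hp hg, mul_assoc, self_mul_cornerProj hp hd]

theorem corner_mul_of_upper (hp : p * p = p) (hd : d * p = p * d * p) :
    corner p (g * d) = corner p g * corner p d := by
  have h : p * (g * d) * p = p * g * p * (p * d * p) := by
    rw [mul_assoc p, mul_assoc g, hd]
    simp only [← mul_assoc]
    rw [mul_assoc (p * g) p p, hp]
  have h3 : p * g * p * (1 - p) = 0 := by rw [mul_sub, mul_one, mul_assoc _ p p, hp, sub_self]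
  have h4 : (1 - p) * (p * d * p) = 0 := by
    rw [sub_mul, one_mul, ← mul_assoc, ← mul_assoc, hp, sub_self]
  have h5 : (1 - p) * (1 - p) = 1 - p := by
    rw [sub_mul, one_mul, mul_sub, mul_one, hp, sub_self, sub_zero]
  rw [corner, corner, corner, h, add_mul, mul_add, mul_add, h3, h4, h5]
  simp

theorem corner_one : corner p 1 = p * p + (1 - p) := by simp [corner]

theorem isUnit_corner_of_upper (hp : p * p = p) (d : Aˣ) (hd : (d : A) * p = p * d * p)
    (hd' : (↑d⁻¹ : A) * p = p * ↑d⁻¹ * p) : IsUnit (corner p (d : A)) := by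
  refine ⟨⟨corner p d, corner p ↑d⁻¹, ?_, ?_⟩, rfl⟩
  · rw [← corner_mul_of_upper hp hd', Units.mul_inv, corner_one, hp, add_sub_cancel]
  · rw [← corner_mul_of_upper hp hd, Units.inv_mul, corner_one, hp, add_sub_cancel]

theorem isUnit_corner_mul_of_upper (hp : p * p = p) (d : Aˣ) (hd : (d : A) * p = p * d * p)
    (hd' : (↑d⁻¹ : A) * p = p * ↑d⁻¹ * p) (hg : IsUnit (corner p g)) :
    IsUnit (corner p (g * d)) := by
  rw [corner_mul_of_upper hp hd]
  exact hg.mul (isUnit_corner_of_upper hp d hd hd')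

theorem cornerProj_mul_of_upper (hp : p * p = p) (d : Aˣ) (hd : (d : A) * p = p * d * p)
    (hd' : (↑d⁻¹ : A) * p = p * ↑d⁻¹ * p) (hg : IsUnit (corner p g)) :
    cornerProj p (g * d) = cornerProj p g := by
  refine cornerProj_eq_of_mul_mul hp hg (isUnit_corner_mul_of_upper hp d hd hd' hg) ?_
  have h : g * d * p = g * p * (d * p) := by
    rw [mul_assoc, hd]
    simp only [← mul_assoc]
    rw [mul_assoc g p p, hp]
  rw [h, ← mul_assoc, cornerProj_mul_mul hp hg]

/-- If `g` and `d` yield the same projection, then `g p A ⊆ d p A`. -/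
theorem upper_of_cornerProj_eq (hp : p * p = p) (g d : Aˣ) (hg : IsUnit (corner p (g : A)))
    (h : cornerProj p (d : A) = cornerProj p (g : A)) :
    (↑(d⁻¹ * g) : A) * p = p * ↑(d⁻¹ * g) * p := by
  have h1 : (g : A) * p = d * (p * Ring.inverse (corner p (d : A)) * g * p) := by
    rw [← cornerProj_mul_mul hp hg, ← h, cornerProj]
    simp only [mul_assoc]
  have h2 : (↑(d⁻¹ * g) : A) * p = p * Ring.inverse (corner p (d : A)) * g * p := by
    rw [Units.val_mul, mul_assoc, h1, Units.inv_mul_cancel_left]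
  rw [mul_assoc, h2]
  simp only [← mul_assoc, hp]

end Corner

/-! ### Commuting chains of idempotents -/

/-- An increasing sequence `P 0 ≤ P 1 ≤ ⋯` of pairwise commuting idempotents with `P 0 = 0` which
has reached `1` after `n + 1` steps. -/
structure IsCommutingChain {A : Type u} [Ring A] (n : ℕ) (P : ℕ → A) : Prop where
  zero : P 0 = 0
  one : ∀ k, n < k → P k = 1
  mul_of_le : ∀ i j, i ≤ j → P i * P j = P i
  mul_of_ge : ∀ i j, i ≤ j → P j * P i = P i

namespace IsCommutingChain

variable {A : Type u} [Ring A] {n : ℕ} {P : ℕ → A} (hP : IsCommutingChain n P)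

include hP

theorem idem (k : ℕ) : P k * P k = P k := hP.mul_of_le k k le_rfl

theorem step_mul_of_lt {k m : ℕ} (h : k < m) : (P (k + 1) - P k) * P m = P (k + 1) - P k := by
  rw [sub_mul, hP.mul_of_le _ _ h, hP.mul_of_le _ _ h.le]

theorem step_mul_of_le {k m : ℕ} (h : m ≤ k) : (P (k + 1) - P k) * P m = 0 := by
  rw [sub_mul, hP.mul_of_ge _ _ (h.trans k.le_succ), hP.mul_of_ge _ _ h, sub_self]

theorem mul_step_of_le {k m : ℕ} (h : m ≤ k) : P m * (P (k + 1) - P k) = 0 := by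
  rw [mul_sub, hP.mul_of_le _ _ (h.trans k.le_succ), hP.mul_of_le _ _ h, sub_self]

theorem mul_step_of_lt {k m : ℕ} (h : k < m) : P m * (P (k + 1) - P k) = P (k + 1) - P k := by
  rw [mul_sub, hP.mul_of_ge _ _ h, hP.mul_of_ge _ _ h.le]

theorem step_mul_step (j k : ℕ) :
    (P (j + 1) - P j) * (P (k + 1) - P k) = if j = k then P (k + 1) - P k else 0 := by
  rcases lt_trichotomy j k with h | rfl | h
  · rw [if_neg h.ne, sub_mul, hP.mul_step_of_le h, hP.mul_step_of_le h.le, sub_self]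
  · rw [if_pos rfl, sub_mul, hP.mul_step_of_lt (Nat.lt_succ_self j), hP.mul_step_of_le le_rfl,
      sub_zero]
  · rw [if_neg h.ne', mul_sub, hP.step_mul_of_le h, hP.step_mul_of_le h.le, sub_self]

theorem sum_step (m : ℕ) : ∑ k ∈ Finset.range m, (P (k + 1) - P k) = P m := by
  rw [Finset.sum_range_sub, hP.zero, sub_zero]

theorem sum_step_eq_one : ∑ k ∈ Finset.range (n + 1), (P (k + 1) - P k) = 1 := by
  rw [hP.sum_step, hP.one _ (Nat.lt_succ_self n)]

end IsCommutingChain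

/-! ### The block LU factorization -/

section Lower

variable {A : Type u} [Ring A] {n : ℕ} {P : ℕ → A}

/-- Strictly lower triangular elements: they map the complement of `P k` to that of `P (k + 1)`. -/
def IsStrictLower (P : ℕ → A) (x : A) : Prop := ∀ k, P (k + 1) * x = P (k + 1) * x * P k

theorem IsStrictLower.mul_mul {x : A} (hP : IsCommutingChain n P) (hx : IsStrictLower P x) (m : ℕ) :
    IsStrictLower P (P m * x * P m) := fun k => by
  rcases le_or_gt (k + 1) m with h | h
  · have h1 : P (k + 1) * (P m * x * P m) = P (k + 1) * x * P k := by
      simp only [← mul_assoc]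
      rw [hP.mul_of_le _ _ h]
      nth_rewrite 1 [hx k]
      rw [mul_assoc, hP.mul_of_le _ _ (Nat.le_of_succ_le h)]
    rw [h1, mul_assoc _ (P k) (P k), hP.idem]
  · rw [mul_assoc (P (k + 1)), mul_assoc _ (P m) (P k), hP.mul_of_le _ _ (Nat.lt_succ_iff.1 h)]

theorem IsStrictLower.isNilpotent {x : A} (hP : IsCommutingChain n P) (hx : IsStrictLower P x) :
    IsNilpotent x := by
  -- `x ^ k` maps into the complement of `P k`.
  have h : ∀ k, P k * x ^ k = 0 := by
    intro k
    induction k with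
    | zero => rw [hP.zero, zero_mul]
    | succ k ih => rw [pow_succ', ← mul_assoc, hx k, mul_assoc, ih, mul_zero]
  refine ⟨n + 1, ?_⟩
  rw [← h (n + 1), hP.one _ (Nat.lt_succ_self n), one_mul]

/-- The elements `g` whose corners `P k g P k` are all invertible; since `P (n + 1) = 1`, such an
element is itself invertible. -/
def bigCell (n : ℕ) (P : ℕ → A) : Set A := {g | ∀ k ∈ Finset.range (n + 2), IsUnit (corner (P k) g)}

theorem isUnit_of_mem_bigCell (hP : IsCommutingChain n P) {g : A} (hg : g ∈ bigCell n P) :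
    IsUnit g := by
  simpa [corner, hP.one _ (Nat.lt_succ_self n)] using hg (n + 1) (by simp)

theorem IsStrictLower.one_add_mem_bigCell {x : A} (hP : IsCommutingChain n P)
    (hx : IsStrictLower P x) : 1 + x ∈ bigCell n P := fun k _ => by
  have h : corner (P k) (1 + x) = 1 + P k * x * P k := by
    rw [corner, mul_add, add_mul, mul_one, hP.idem]
    abel
  -- The corner of a strictly lower triangular element is again strictly lower triangular.
  rw [h]
  exact ((hx.mul_mul hP k).isNilpotent hP).isUnit_one_add

/-- The projection of `A` onto the space of strictly lower triangular elements. -/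
def strictLowerPart (n : ℕ) (P : ℕ → A) (y : A) : A :=
  ∑ k ∈ Finset.range (n + 1), (1 - P (k + 1)) * y * (P (k + 1) - P k)

theorem isStrictLower_strictLowerPart (hP : IsCommutingChain n P) (y : A) :
    IsStrictLower P (strictLowerPart n P y) := fun m => by
  rw [strictLowerPart, mul_assoc, Finset.sum_mul, Finset.mul_sum, Finset.mul_sum]
  refine Finset.sum_congr rfl fun k _ => ?_
  rcases le_or_gt m k with h | h
  · have h1 : P (m + 1) * (1 - P (k + 1)) = 0 := by
      rw [mul_sub, mul_one, hP.mul_of_le _ _ (Nat.succ_le_succ h), sub_self]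
    simp only [← mul_assoc, h1, zero_mul]
  · rw [mul_assoc _ _ (P m), hP.step_mul_of_lt h]

theorem IsStrictLower.strictLowerPart_eq {x : A} (hP : IsCommutingChain n P)
    (hx : IsStrictLower P x) : strictLowerPart n P x = x := by
  have h : ∀ k, (1 - P (k + 1)) * x * (P (k + 1) - P k) = x * (P (k + 1) - P k) := fun k => by
    rw [sub_mul, one_mul, hx k, sub_mul, mul_assoc _ (P k), hP.mul_step_of_le le_rfl, mul_zero,
      sub_zero]
  simp only [strictLowerPart, h]
  rw [← Finset.mul_sum, hP.sum_step_eq_one, mul_one]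

/-- For `g` in the big cell, the unique strictly lower triangular `x` such that `1 + x` is the
unipotent factor in the factorization of `g` into a unipotent lower triangular and an upper
triangular element. The `k`-th column of `1 + x` is the `k`-th column of the projection onto
`g (P (k + 1)) A`. -/
noncomputable def lowerCoord (n : ℕ) (P : ℕ → A) (g : A) : A :=
  strictLowerPart n P (∑ k ∈ Finset.range (n + 1), cornerProj (P (k + 1)) g * (P (k + 1) - P k))

theorem lowerCoord_congr {g d : A}
    (h : ∀ k ∈ Finset.range (n + 2), cornerProj (P k) g = cornerProj (P k) d) :
    lowerCoord n P g = lowerCoord n P d := by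
  unfold lowerCoord
  congr 1
  refine Finset.sum_congr rfl fun k hk => ?_
  rw [h (k + 1) (by simp at hk ⊢; omega)]

theorem one_add_lowerCoord (hP : IsCommutingChain n P) {g : A} (hg : g ∈ bigCell n P) :
    1 + lowerCoord n P g =
      ∑ k ∈ Finset.range (n + 1), cornerProj (P (k + 1)) g * (P (k + 1) - P k) := by
  nth_rewrite 1 [← hP.sum_step_eq_one]
  rw [lowerCoord, strictLowerPart, ← Finset.sum_add_distrib]
  refine Finset.sum_congr rfl fun k hk => ?_
  rw [mul_assoc, Finset.sum_mul]
  simp only [mul_assoc, hP.step_mul_step, mul_ite, mul_zero, Finset.sum_ite_eq', hk, if_true]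
  rw [sub_mul, one_mul, ← mul_assoc (P (k + 1)),
    self_mul_cornerProj (hP.idem _) (hg (k + 1) (by simp at hk ⊢; omega)),
    hP.mul_step_of_lt (Nat.lt_succ_self k)]
  abel

theorem lowerCoord_one_add (hP : IsCommutingChain n P) {x : A} (hx : IsStrictLower P x) :
    lowerCoord n P (1 + x) = x := by
  have hg := hx.one_add_mem_bigCell hP
  have h : ∑ k ∈ Finset.range (n + 1), cornerProj (P (k + 1)) (1 + x) * (P (k + 1) - P k)
      = 1 + x := by
    have hsum : ∑ k ∈ Finset.range (n + 1), (1 + x) * (P (k + 1) - P k) = 1 + x := by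
      rw [← Finset.mul_sum, hP.sum_step_eq_one, mul_one]
    refine (Finset.sum_congr rfl fun k hk => ?_).trans hsum
    have hk' := hg (k + 1) (by simp at hk ⊢; omega)
    -- The `k`-th column of `x` lies in the kernel `(1 - P (k + 1)) A` of the projection.
    have h1 : P (k + 1) * (x * (P (k + 1) - P k)) = 0 := by
      rw [← mul_assoc, hx k, mul_assoc, hP.mul_step_of_le le_rfl, mul_zero]
    have h2 : cornerProj (P (k + 1)) (1 + x) * (x * (P (k + 1) - P k)) = 0 := by
      rw [← cornerProj_mul_self (hP.idem _) hk', mul_assoc, h1, mul_zero]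
    have h3 := cornerProj_mul_mul (hP.idem _) hk'
    have h4 : cornerProj (P (k + 1)) (1 + x) * ((1 + x) * (P (k + 1) - P k))
        = (1 + x) * (P (k + 1) - P k) := by
      rw [← hP.mul_step_of_lt (Nat.lt_succ_self k), ← mul_assoc (1 + x), ← mul_assoc, h3]
    rw [← h4, add_mul, one_mul, mul_add, h2, add_zero]
  rw [lowerCoord, h]
  have h1 : strictLowerPart n P (1 : A) = 0 := by
    refine Finset.sum_eq_zero fun k _ => ?_
    rw [mul_one, sub_mul, one_mul, hP.mul_step_of_lt (Nat.lt_succ_self k), sub_self]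
  have h2 : strictLowerPart n P (1 + x) = strictLowerPart n P 1 + strictLowerPart n P x := by
    simp only [strictLowerPart, mul_add, add_mul, Finset.sum_add_distrib]
  rw [h2, h1, zero_add, hx.strictLowerPart_eq hP]

theorem isStrictLower_lowerCoord (hP : IsCommutingChain n P) (g : A) :
    IsStrictLower P (lowerCoord n P g) :=
  isStrictLower_strictLowerPart hP _

/-- `g` and its unipotent lower triangular factor define the same flag. -/
theorem cornerProj_one_add_lowerCoord (hP : IsCommutingChain n P) {g : A} (hg : g ∈ bigCell n P)
    {m : ℕ} (hm : m ∈ Finset.range (n + 2)) :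
    cornerProj (P m) (1 + lowerCoord n P g) = cornerProj (P m) g := by
  -- The first `m` columns of `1 + x` lie in `g (P m) A`, as the right ideals `g (P k) A` increase.
  refine cornerProj_eq_of_mul_mul (hP.idem m) (hg m hm)
    ((isStrictLower_lowerCoord hP g).one_add_mem_bigCell hP m hm) ?_
  rw [one_add_lowerCoord hP hg, Finset.sum_mul, Finset.mul_sum]
  refine Finset.sum_congr rfl fun k _ => ?_
  rcases le_or_gt m k with h | h
  · rw [mul_assoc, hP.step_mul_of_le h, mul_zero, mul_zero]
  · rw [mul_assoc, hP.step_mul_of_lt h, ← mul_assoc]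
    congr 1
    have h1 : g * P (k + 1) = g * P m * P (k + 1) := by rw [mul_assoc, hP.mul_of_ge _ _ h]
    rw [cornerProj.eq_1 (P (k + 1)), ← mul_assoc, h1, ← mul_assoc,
      cornerProj_mul_mul (hP.idem m) (hg m hm)]

/-- The unipotent lower triangular element `1 + x`. -/
noncomputable def unipotent (hP : IsCommutingChain n P) (x : A) (hx : IsStrictLower P x) : Aˣ :=
  (isUnit_of_mem_bigCell hP (hx.one_add_mem_bigCell hP)).unit

theorem unipotent_mem_bigCell (hP : IsCommutingChain n P) (x : A) (hx : IsStrictLower P x) :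
    (unipotent hP x hx : A) ∈ bigCell n P := hx.one_add_mem_bigCell hP

end Lower

/-! ### Products of complements -/

section ComplProd

variable {A : Type u} [Ring A]

/-- The product `(1 - p 0) ⋯ (1 - p (k - 1))`, a projection with the same kernel
as `1 - p (k - 1)` if `p` is increasing. -/
def complProd (p : ℕ → A) : ℕ → A
  | 0 => 1
  | k + 1 => complProd p k * (1 - p k)

variable {p : ℕ → A} (hp : ∀ i j, i ≤ j → p j * p i = p i)
include hp

theorem compl_mul_complProd {j k : ℕ} (h : k ≤ j + 1) : (1 - p j) * complProd p k = 1 - p j := by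
  induction k with
  | zero => rw [complProd, mul_one]
  | succ k ih =>
    rw [complProd, ← mul_assoc, ih (by omega), sub_mul, one_mul, mul_sub, mul_one,
      hp k j (by omega)]
    abel

theorem complProd_mul_of_ge {i j : ℕ} (h : i ≤ j) :
    complProd p j * complProd p i = complProd p j := by
  cases j with
  | zero => rw [Nat.le_zero.1 h, complProd, mul_one]
  | succ j => rw [complProd, mul_assoc, compl_mul_complProd hp h]

theorem complProd_mul_of_le {i j : ℕ} (h : i ≤ j) :
    complProd p i * complProd p j = complProd p j := by
  induction j, h using Nat.le_induction with
  | base => exact complProd_mul_of_ge hp le_rfl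
  | succ j _ ih => rw [complProd, ← mul_assoc, ih]

end ComplProd

/-! ### Stabilizers of flags -/

section Stabilizer

variable {A : Type u} [Ring A] {n : ℕ}

theorem flag_eq_iff {δ δ' : FlagTuple A n} :
    flag δ = flag δ' ↔ ∀ j, (δ.1 j).1 * (δ'.1 j).1 = (δ'.1 j).1 ∧
      (δ'.1 j).1 * (δ.1 j).1 = (δ.1 j).1 :=
  ⟨fun h => Quotient.exact h, fun h => Quotient.sound h⟩

theorem smul_flag (g : Aˣ) (δ : FlagTuple A n) : g • flag δ = flag (conjTuple g δ) := rfl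

variable [Algebra ℂ A]

theorem mem_upperUnits {δ : FlagTuple A n} {g : Aˣ} :
    g ∈ upperUnits δ ↔ ∀ k, (g : A) * (δ.1 k).1 = (δ.1 k).1 * g * (δ.1 k).1 ∧
      (↑g⁻¹ : A) * (δ.1 k).1 = (δ.1 k).1 * ↑g⁻¹ * (δ.1 k).1 := by
  rw [upperUnits, Submonoid.mem_units_iff, forall_and]
  rfl

theorem smul_flag_eq_self_iff {δ : FlagTuple A n} {g : Aˣ} :
    g • flag δ = flag δ ↔ g ∈ upperUnits δ := by
  rw [smul_flag, flag_eq_iff, mem_upperUnits]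
  refine forall_congr' fun k => ?_
  set p := (δ.1 k).1
  change (g : A) * p * ↑g⁻¹ * p = p ∧ p * ((g : A) * p * ↑g⁻¹) = (g : A) * p * ↑g⁻¹ ↔ _
  rw [and_comm]
  refine and_congr ?_ ?_
  · rw [← mul_assoc, Units.mul_inv_eq_iff_eq_mul, Units.inv_mul_cancel_right, ← mul_assoc]
    exact eq_comm
  · rw [mul_assoc, mul_assoc, ← Units.eq_inv_mul_iff_mul_eq, ← mul_assoc]
    exact eq_comm

theorem smul_flag_eq_smul_iff {δ : FlagTuple A n} {g d : Aˣ} :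
    g • flag δ = d • flag δ ↔ g⁻¹ * d ∈ upperUnits δ := by
  rw [← smul_flag_eq_self_iff, mul_smul, inv_smul_eq_iff]
  exact eq_comm

end Stabilizer

/-! ### Commuting representatives of flags -/

section CommutingRepresentative

variable {A : Type u} [Ring A] {n : ℕ}

/-- The tuple `(P 1, …, P n)`. -/
def IsCommutingChain.tuple {P : ℕ → A} (hP : IsCommutingChain n P) : FlagTuple A n :=
  ⟨fun k => ⟨P (k + 1), hP.idem _⟩, fun _ _ hij => hP.mul_of_ge _ _ (Nat.succ_le_succ hij)⟩

/-- Every flag is represented by pairwise commuting idempotents: `(p 0, p 1, …)` is equivalent to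
the sequence of the `1 - (1 - p 0) ⋯ (1 - p k)`. -/
theorem exists_isCommutingChain (X : Fl A n) :
    ∃ (P : ℕ → A) (hP : IsCommutingChain n P), flag hP.tuple = X := by
  induction X using Quotient.inductionOn with
  | h δ =>
    -- Continuing the tuple by `1` makes the chain reach `1` at step `n + 1`.
    let p : ℕ → A := fun k => if h : k < n then (δ.1 ⟨k, h⟩).1 else 1
    have hp : ∀ i j, i ≤ j → p j * p i = p i := fun i j hij => by
      by_cases hj : j < n
      · have hi : i < n := hij.trans_lt hj
        simp only [p, dif_pos hi, dif_pos hj]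
        exact δ.2 ⟨i, hi⟩ ⟨j, hj⟩ hij
      · simp only [p, dif_neg hj, one_mul]
    have hP : IsCommutingChain n (fun k => 1 - complProd p k) :=
      { zero := by simp [complProd]
        one := fun k hk => by
          obtain ⟨k, rfl⟩ := Nat.exists_eq_succ_of_ne_zero (Nat.ne_zero_of_lt hk)
          have hk' : ¬ k < n := by omega
          simp [complProd, p, hk']
        mul_of_le := fun i j hij => by
          rw [sub_mul, one_mul, mul_sub, mul_one, complProd_mul_of_le hp hij]
          abel
        mul_of_ge := fun i j hij => by
          rw [sub_mul, one_mul, mul_sub, mul_one, complProd_mul_of_ge hp hij]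
          abel }
    refine ⟨_, hP, flag_eq_iff.2 fun k => ?_⟩
    have hk : (δ.1 k).1 = p k := by simp [p]
    change (1 - complProd p (k + 1)) * (δ.1 k).1 = (δ.1 k).1 ∧
      (δ.1 k).1 * (1 - complProd p (k + 1)) = 1 - complProd p (k + 1)
    rw [hk]
    have hkk : p k * p k = p k := hp _ _ le_rfl
    have h1 := compl_mul_complProd hp (j := k) (k := k + 1) le_rfl
    constructor
    · have h2 : complProd p (k + 1) * p k = 0 := by
        rw [complProd, mul_assoc, sub_mul, one_mul, hkk, sub_self, mul_zero]
      rw [sub_mul, h2, one_mul, sub_zero]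
    · rw [sub_mul, one_mul] at h1
      rw [mul_sub, mul_one, ← sub_eq_zero]
      rw [← sub_eq_zero] at h1
      rw [← h1]
      abel

end CommutingRepresentative

/-! ### The topology of the orbits -/

section Topology

variable {A : Type u} [Ring A] {n : ℕ}

theorem surjective_orbitMap (X : Fl A n) : Function.Surjective (orbitMap X) := by
  rintro ⟨_, g, rfl⟩
  exact ⟨g, rfl⟩

/-- An element of `A^×` which maps the base flag to the given point of the orbit. -/
noncomputable def orbitRep {X : Fl A n} (Y : MulAction.orbit Aˣ X) : Aˣ :=
  (surjective_orbitMap X Y).choose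

theorem orbitMap_orbitRep {X : Fl A n} (Y : MulAction.orbit Aˣ X) : orbitMap X (orbitRep Y) = Y :=
  (surjective_orbitMap X Y).choose_spec

theorem smul_orbitRep_orbitMap {X : Fl A n} (h g : Aˣ) :
    (h⁻¹ * orbitRep (orbitMap X g)) • X = (h⁻¹ * g) • X := by
  rw [mul_smul, mul_smul]
  exact congrArg (h⁻¹ • ·) (congrArg Subtype.val (orbitMap_orbitRep (orbitMap X g)))

theorem injective_toGr : Function.Injective (toGr : Fl A n → Fin n → Gr A) := by
  intro X Y
  induction X using Quotient.inductionOn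
  induction Y using Quotient.inductionOn
  exact fun h => Quotient.sound fun j => Quotient.exact (congrFun h j)

variable [TopologicalSpace A]

theorem continuous_smul_const (X : Fl A n) : Continuous fun g : Aˣ => g • X :=
  continuous_iff_coinduced_le.2 (le_iSup (fun X : Fl A n =>
    TopologicalSpace.coinduced (fun g : Aˣ => g • X) inferInstance) X)

theorem continuous_orbitMap (X : Fl A n) : Continuous (orbitMap X) :=
  (continuous_smul_const X).subtype_mk _

theorem isOpenMap_orbitMap [ContinuousMul A] (X : Fl A n) : IsOpenMap (orbitMap X) := by
  intro V hV
  have h : IsOpen ((fun g : Aˣ => g • X) '' V) := by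
    refine isOpen_iSup_iff.2 fun Y => isOpen_coinduced.2 (isOpen_iff_mem_nhds.2 ?_)
    rintro g ⟨v, hv, hgv⟩
    -- If `g • Y = v • X`, then `g' • Y = (g' * g⁻¹ * v) • X` for all `g'`.
    have hc : Continuous fun g' : Aˣ => g' * (g⁻¹ * v) := continuous_mul_const _
    refine Filter.mem_of_superset ((hV.preimage hc).mem_nhds (by simpa using hv)) fun g' hg' => ?_
    refine ⟨_, hg', ?_⟩
    change v • X = g • Y at hgv
    change (g' * (g⁻¹ * v)) • X = g' • Y
    rw [mul_smul, mul_smul, hgv, inv_smul_smul]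
  convert h.preimage continuous_subtype_val using 1
  ext Y
  constructor
  · rintro ⟨g, hg, rfl⟩
    exact ⟨g, hg, rfl⟩
  · rintro ⟨g, hg, hgY⟩
    exact ⟨g, hg, Subtype.ext hgY⟩

theorem isOpenQuotientMap_orbitMap [ContinuousMul A] (X : Fl A n) :
    IsOpenQuotientMap (orbitMap X) :=
  ⟨surjective_orbitMap X, continuous_orbitMap X, isOpenMap_orbitMap X⟩

theorem continuous_action [ContinuousMul A] (X : Fl A n) :
    Continuous fun x : Aˣ × MulAction.orbit Aˣ X => x.1 • x.2 := by
  have hq := IsOpenQuotientMap.id.prodMap (isOpenQuotientMap_orbitMap X) (X := Aˣ)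
  rw [hq.isQuotientMap.continuous_iff]
  have h : Continuous fun x : Aˣ × Aˣ => orbitMap X (x.1 * x.2) :=
    (continuous_orbitMap X).comp continuous_mul
  refine h.congr fun x => Subtype.ext ?_
  exact mul_smul x.1 x.2 X

theorem continuous_toGr [ContinuousMul A] :
    Continuous (toGr : Fl A n → Fin n → Gr A) := by
  refine continuous_iSup_dom.2 fun X => continuous_coinduced_dom.2 (continuous_pi fun j => ?_)
  induction X using Quotient.inductionOn with
  | h δ =>
    have hv : Continuous (Units.val : Aˣ → A) := Units.continuous_val
    have hi : Continuous fun g : Aˣ => (↑g⁻¹ : A) := Units.continuous_val.comp continuous_inv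
    have h : Continuous fun g : Aˣ => conjIdem g (δ.1 j) :=
      Continuous.subtype_mk (by fun_prop) _
    exact continuous_quotient_mk'.comp h

variable [Algebra ℂ A]

theorem isClosed_upperUnits [ContinuousMul A] [T2Space A] (δ : FlagTuple A n) :
    IsClosed (upperUnits δ : Set Aˣ) := by
  have h : (upperUnits δ : Set Aˣ) =
      {g : Aˣ | ∀ k, (g : A) * (δ.1 k).1 = (δ.1 k).1 * g * (δ.1 k).1 ∧
        (↑g⁻¹ : A) * (δ.1 k).1 = (δ.1 k).1 * ↑g⁻¹ * (δ.1 k).1} := by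
    ext g
    exact mem_upperUnits
  have hv : Continuous (Units.val : Aˣ → A) := Units.continuous_val
  have hi : Continuous fun g : Aˣ => (↑g⁻¹ : A) := Units.continuous_val.comp continuous_inv
  rw [h]
  simp only [Set.ofPred_forall, Set.ofPred_and]
  refine isClosed_iInter fun k => IsClosed.inter ?_ ?_
  · exact isClosed_eq (by fun_prop) (by fun_prop)
  · exact isClosed_eq (by fun_prop) (by fun_prop)

theorem t2Space_orbit [ContinuousMul A] [T2Space A] (δ : FlagTuple A n) :
    T2Space (MulAction.orbit Aˣ (flag δ)) := by
  rw [t2Space_iff_of_isOpenQuotientMap (isOpenQuotientMap_orbitMap (flag δ))]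
  have hc : Continuous fun q : Aˣ × Aˣ => q.1⁻¹ * q.2 := by fun_prop
  convert (isClosed_upperUnits δ).preimage hc using 1
  ext q
  exact Subtype.ext_iff.trans smul_flag_eq_smul_iff

theorem exists_homeomorph_orbit [ContinuousMul A] (δ : FlagTuple A n) :
    ∃ φ : (Aˣ ⧸ upperUnits δ) ≃ₜ MulAction.orbit Aˣ (flag δ),
      ∀ g : Aˣ, φ (g : Aˣ ⧸ upperUnits δ) = orbitMap (flag δ) g := by
  have hiff : ∀ g d : Aˣ, orbitMap (flag δ) g = orbitMap (flag δ) d ↔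
      (g : Aˣ ⧸ upperUnits δ) = d := fun g d => by
    rw [QuotientGroup.eq]
    exact Subtype.ext_iff.trans smul_flag_eq_smul_iff
  let f : Aˣ ⧸ upperUnits δ → MulAction.orbit Aˣ (flag δ) :=
    Quotient.lift (orbitMap (flag δ)) fun g d h => (hiff g d).2 (Quotient.sound h)
  have hf : ∀ g : Aˣ, f (g : Aˣ ⧸ upperUnits δ) = orbitMap (flag δ) g := fun _ => rfl
  have hbij : Function.Bijective f := by
    constructor
    · intro x y
      induction x using QuotientGroup.induction_on
      induction y using QuotientGroup.induction_on
      exact (hiff _ _).1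
    · intro Y
      obtain ⟨g, rfl⟩ := surjective_orbitMap _ Y
      exact ⟨g, rfl⟩
  have hcont : Continuous f := (continuous_orbitMap _).quotient_lift _
  have hopen : IsOpenMap f := by
    intro V hV
    have h := isOpenMap_orbitMap (flag δ) _ (hV.preimage QuotientGroup.continuous_mk)
    convert h using 1
    ext Y
    constructor
    · rintro ⟨x, hx, rfl⟩
      induction x using QuotientGroup.induction_on with
      | H g => exact ⟨g, hx, rfl⟩
    · rintro ⟨g, hg, rfl⟩
      exact ⟨g, hg, rfl⟩
  exact ⟨(Equiv.ofBijective f hbij).toHomeomorphOfContinuousOpen hcont hopen, fun _ => rfl⟩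

end Topology

/-! ### The flags of elements of the big cell -/

section Cell

variable {A : Type u} [Ring A] [Algebra ℂ A] {n : ℕ} {P : ℕ → A}

theorem upper_of_mem_upperUnits (hP : IsCommutingChain n P) {d : Aˣ}
    (hd : d ∈ upperUnits hP.tuple) (k : ℕ) : (d : A) * P k = P k * d * P k := by
  rcases k with _ | k
  · simp [hP.zero]
  · rcases lt_or_ge k n with hk | hk
    · exact ((mem_upperUnits.1 hd) ⟨k, hk⟩).1
    · simp [hP.one (k + 1) (Nat.lt_succ_iff.2 hk)]

theorem mem_bigCell_of_smul_eq (hP : IsCommutingChain n P) {g d : Aˣ}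
    (hg : (g : A) ∈ bigCell n P) (h : g • flag hP.tuple = d • flag hP.tuple) :
    (d : A) ∈ bigCell n P := fun k hk => by
  have hd := smul_flag_eq_smul_iff.1 h
  have h1 := isUnit_corner_mul_of_upper (hP.idem k) _ (upper_of_mem_upperUnits hP hd k)
    (upper_of_mem_upperUnits hP (inv_mem hd) k) (hg k hk)
  rwa [← Units.val_mul, mul_inv_cancel_left] at h1

theorem cornerProj_eq_of_smul_eq (hP : IsCommutingChain n P) {g d : Aˣ}
    (hg : (g : A) ∈ bigCell n P) (h : g • flag hP.tuple = d • flag hP.tuple) {k : ℕ}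
    (hk : k ∈ Finset.range (n + 2)) :
    cornerProj (P k) (d : A) = cornerProj (P k) (g : A) := by
  have hd := smul_flag_eq_smul_iff.1 h
  have h1 := cornerProj_mul_of_upper (hP.idem k) _ (upper_of_mem_upperUnits hP hd k)
    (upper_of_mem_upperUnits hP (inv_mem hd) k) (hg k hk)
  rwa [← Units.val_mul, mul_inv_cancel_left] at h1

theorem smul_eq_of_cornerProj_eq (hP : IsCommutingChain n P) {g d : Aˣ}
    (hg : (g : A) ∈ bigCell n P) (hd : (d : A) ∈ bigCell n P)
    (h : ∀ k ∈ Finset.range (n + 2), cornerProj (P k) (d : A) = cornerProj (P k) (g : A)) :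
    g • flag hP.tuple = d • flag hP.tuple := by
  refine smul_flag_eq_smul_iff.2 (mem_upperUnits.2 fun k => ?_)
  have hk : (k : ℕ) + 1 ∈ Finset.range (n + 2) := by simp
  rw [mul_inv_rev, inv_inv]
  exact ⟨upper_of_cornerProj_eq (hP.idem _) d g (hd _ hk) (h _ hk).symm,
    upper_of_cornerProj_eq (hP.idem _) g d (hg _ hk) (h _ hk)⟩

theorem unipotent_lowerCoord_smul (hP : IsCommutingChain n P) {g : Aˣ}
    (hg : (g : A) ∈ bigCell n P) :
    unipotent hP _ (isStrictLower_lowerCoord hP (g : A)) • flag hP.tuple = g • flag hP.tuple :=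
  (smul_eq_of_cornerProj_eq hP hg (unipotent_mem_bigCell hP _ _)
    fun _ hk => cornerProj_one_add_lowerCoord hP hg hk).symm

theorem orbitRep_mem_bigCell_iff (hP : IsCommutingChain n P) (h g : Aˣ) :
    (↑(h⁻¹ * orbitRep (orbitMap (flag hP.tuple) g)) : A) ∈ bigCell n P ↔
      (↑(h⁻¹ * g) : A) ∈ bigCell n P :=
  ⟨fun hg => mem_bigCell_of_smul_eq hP hg (smul_orbitRep_orbitMap h g),
    fun hg => mem_bigCell_of_smul_eq hP hg (smul_orbitRep_orbitMap h g).symm⟩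

end Cell

/-! ### The model space and the coordinate map -/

section ModelSpace

variable {A : Type u} [Ring A] [Algebra ℂ A] [TopologicalSpace A] [ContinuousInverseAlgebra A]
  {n : ℕ} {P : ℕ → A}

instance continuousSMulReal : ContinuousSMul ℝ A := IsScalarTower.continuousSMul ℂ

/-- The model space of the flag manifold: the strictly lower triangular elements. -/
def strictLower (P : ℕ → A) : Submodule ℝ A where
  carrier := {x | IsStrictLower P x}
  add_mem' hx hy k := by rw [mul_add, add_mul, ← hx k, ← hy k]
  zero_mem' k := by simp
  smul_mem' c x hx k := by rw [mul_smul_comm, smul_mul_assoc, ← hx k]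

/-- The projection `strictLowerPart` as a continuous linear map onto the model space. -/
def strictLowerProj (hP : IsCommutingChain n P) : A →L[ℝ] strictLower P where
  toFun y := ⟨strictLowerPart n P y, isStrictLower_strictLowerPart hP y⟩
  map_add' y z := Subtype.ext <| by
    simp only [strictLowerPart, mul_add, add_mul, Finset.sum_add_distrib, Submodule.coe_add]
  map_smul' c y := Subtype.ext <| by
    simp only [strictLowerPart, mul_smul_comm, smul_mul_assoc, Finset.smul_sum, RingHom.id_apply,
      Submodule.coe_smul]
  cont := Continuous.subtype_mk (by unfold strictLowerPart; fun_prop) _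

/-- The coordinate `lowerCoord` with values in the model space. -/
noncomputable def cellCoord (hP : IsCommutingChain n P) (g : A) : strictLower P :=
  ⟨lowerCoord n P g, isStrictLower_lowerCoord hP g⟩

theorem continuous_corner (p : A) : Continuous (corner p) := by
  unfold corner
  fun_prop

theorem isOpen_bigCell (n : ℕ) (P : ℕ → A) : IsOpen (bigCell n P) := by
  have h : bigCell n P = ⋂ k ∈ Finset.range (n + 2), corner (P k) ⁻¹' {a | IsUnit a} := by
    ext g
    simp [bigCell]
  rw [h]
  exact isOpen_biInter_finset fun k _ =>
    ContinuousInverseAlgebra.isOpen_units.preimage (continuous_corner _)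

theorem isSlopeCk_cellCoord (hP : IsCommutingChain n P) (k : ℕ) :
    IsSlopeCk k (cellCoord hP) (bigCell n P) := by
  refine IsSlopeCk.clm_comp (strictLowerProj hP) (IsSlopeCk.sum _ fun j hj => ?_)
  have hid : IsSlopeCk k (fun g : A => g) (bigCell n P) := IsSlopeCk.clm k (.id ℝ A) _
  have hcorner : IsSlopeCk k (corner (P (j + 1))) (bigCell n P) :=
    (((IsSlopeCk.const k _ _).mul hid).mul (.const k _ _)).add (.const k _ _)
  have hinv := IsSlopeCk.comp
    (IsSlopeCk.ringInverse ContinuousInverseAlgebra.continuousOn_inverse k) hcorner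
    fun g hg => hg (j + 1) (by simp at hj ⊢; omega)
  exact ((hid.mul (.const k _ _)).mul hinv).mul (.const k _ _)

theorem continuous_unipotent (hP : IsCommutingChain n P) :
    Continuous fun x : strictLower P => unipotent hP x.1 x.2 := by
  rw [(ContinuousInverseAlgebra.isOpenEmbedding_val A).isInducing.continuous_iff]
  exact continuous_const.add continuous_subtype_val

end ModelSpace

/-! ### The atlas -/

section Chart

variable {A : Type u} [Ring A] [Algebra ℂ A] [TopologicalSpace A] [ContinuousInverseAlgebra A]
  {n : ℕ} {P : ℕ → A}

theorem cellCoord_orbitRep (hP : IsCommutingChain n P) {h g : Aˣ}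
    (hg : (↑(h⁻¹ * g) : A) ∈ bigCell n P) :
    cellCoord hP ↑(h⁻¹ * orbitRep (orbitMap (flag hP.tuple) g)) = cellCoord hP ↑(h⁻¹ * g) :=
  Subtype.ext (lowerCoord_congr fun _ hk =>
    cornerProj_eq_of_smul_eq hP hg (smul_orbitRep_orbitMap h g).symm hk)

theorem isOpen_orbitRep_mem_bigCell (hP : IsCommutingChain n P) (h : Aˣ) :
    IsOpen {Y : MulAction.orbit Aˣ (flag hP.tuple) |
      (↑(h⁻¹ * orbitRep Y) : A) ∈ bigCell n P} := by
  rw [← (isOpenQuotientMap_orbitMap _).isQuotientMap.isOpen_preimage]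
  have hc : Continuous fun g : Aˣ => (↑(h⁻¹ * g) : A) :=
    Units.continuous_val.comp (continuous_const_mul _)
  convert (isOpen_bigCell n P).preimage hc using 1
  ext g
  exact orbitRep_mem_bigCell_iff hP h g

/-- The chart around `h • X`, where `X` is the base flag: the inverse of `x ↦ h (1 + x) • X`, which
is defined on the whole model space. -/
noncomputable def flagChart (hP : IsCommutingChain n P) (h : Aˣ) :
    OpenPartialHomeomorph (MulAction.orbit Aˣ (flag hP.tuple)) (strictLower P) where
  toFun Y := cellCoord hP ↑(h⁻¹ * orbitRep Y)
  invFun x := orbitMap (flag hP.tuple) (h * unipotent hP x.1 x.2)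
  source := {Y | (↑(h⁻¹ * orbitRep Y) : A) ∈ bigCell n P}
  target := Set.univ
  map_source' _ _ := Set.mem_univ _
  map_target' x _ := by
    rw [Set.mem_ofPred_eq, orbitRep_mem_bigCell_iff, inv_mul_cancel_left]
    exact unipotent_mem_bigCell hP _ _
  left_inv' Y hY := by
    conv_rhs => rw [← orbitMap_orbitRep Y]
    have h1 := unipotent_lowerCoord_smul hP hY
    rw [mul_smul, eq_inv_smul_iff, ← mul_smul] at h1
    exact Subtype.ext h1
  right_inv' x _ := by
    have h1 : (↑(h⁻¹ * (h * unipotent hP x.1 x.2)) : A) = 1 + x.1 := by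
      rw [inv_mul_cancel_left]
      rfl
    rw [cellCoord_orbitRep hP (by rw [h1]; exact x.2.one_add_mem_bigCell hP), h1]
    exact Subtype.ext (lowerCoord_one_add hP x.2)
  open_source := isOpen_orbitRep_mem_bigCell hP h
  open_target := isOpen_univ
  continuousOn_toFun := by
    have hc : Continuous fun g : Aˣ => (↑(h⁻¹ * g) : A) :=
      Units.continuous_val.comp (continuous_const_mul _)
    refine ((isOpenQuotientMap_orbitMap _).isQuotientMap.continuousOn_isOpen_iff
      (isOpen_orbitRep_mem_bigCell hP h)).2 ?_
    refine ((isSlopeCk_cellCoord hP 0).continuousOn.comp hc.continuousOn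
      fun g hg => (orbitRep_mem_bigCell_iff hP h g).1 hg).congr fun g hg => ?_
    exact cellCoord_orbitRep hP ((orbitRep_mem_bigCell_iff hP h g).1 hg)
  continuousOn_invFun :=
    ((continuous_orbitMap _).comp ((continuous_const_mul h).comp
      (continuous_unipotent hP))).continuousOn

/-- The charted space structure of an orbit of flags. -/
@[reducible]
noncomputable def flagCharted (hP : IsCommutingChain n P) :
    ChartedSpace (strictLower P) (MulAction.orbit Aˣ (flag hP.tuple)) where
  atlas := Set.range (flagChart hP)
  chartAt Y := flagChart hP (orbitRep Y)
  mem_chart_source Y := by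
    change (↑((orbitRep Y)⁻¹ * orbitRep Y) : A) ∈ bigCell n P
    have h0 : IsStrictLower P (0 : A) := fun k => by simp
    simpa using h0.one_add_mem_bigCell hP
  chart_mem_atlas Y := ⟨_, rfl⟩

/-- A map into the orbit is smooth in a chart if it lifts to a smooth map into `A^×`. -/
theorem isSmoothOn_flagChart_comp (hP : IsCommutingChain n P) (h : Aˣ) {E : Type v}
    [AddCommGroup E] [Module ℝ E] [TopologicalSpace E] [ContinuousAdd E] [ContinuousSMul ℝ E]
    {f : E → MulAction.orbit Aˣ (flag hP.tuple)} {U : Set E} (hU : IsOpen U)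
    (hfU : Set.MapsTo f U (flagChart hP h).source) (F : E → Aˣ)
    (hF : ∀ x ∈ U, f x = orbitMap (flag hP.tuple) (F x))
    (hsmooth : ∀ k, IsSlopeCk k (fun x => (F x : A)) U) :
    IsSmoothOn (flagChart hP h ∘ f) U := by
  have hcell : ∀ x ∈ U, (↑(h⁻¹ * F x) : A) ∈ bigCell n P := fun x hx => by
    have h1 := hfU hx
    rw [hF x hx] at h1
    exact (orbitRep_mem_bigCell_iff hP h _).1 h1
  refine IsSlopeCk.isSmoothOn hU fun k => IsSlopeCk.congr
    (IsSlopeCk.comp (isSlopeCk_cellCoord hP k) (g := fun x => (↑h⁻¹ : A) * F x)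
      ((IsSlopeCk.const k _ _).mul (hsmooth k)) hcell) fun x hx => ?_
  change cellCoord hP ↑(h⁻¹ * orbitRep (f x)) = cellCoord hP ↑(h⁻¹ * F x)
  rw [hF x hx]
  exact cellCoord_orbitRep hP (hcell x hx)

theorem isSlopeCk_val_unipotent (hP : IsCommutingChain n P) (h : Aˣ) (k : ℕ)
    (U : Set (strictLower P)) :
    IsSlopeCk k (fun x : strictLower P => (↑(h * unipotent hP x.1 x.2) : A)) U :=
  (IsSlopeCk.const k (h : A) U).mul
    ((IsSlopeCk.const k 1 U).add (IsSlopeCk.clm k (strictLower P).subtypeL U))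

theorem val_of_mem_atlas_units {e : OpenPartialHomeomorph Aˣ A} (he : e ∈ atlas A Aˣ) {a : A}
    (ha : a ∈ e.target) : (e.symm a : A) = a := by
  obtain rfl : e = (ContinuousInverseAlgebra.isOpenEmbedding_val A).toOpenPartialHomeomorph _ := he
  exact OpenPartialHomeomorph.right_inv _ ha

theorem isSmoothManifold_orbit (hP : IsCommutingChain n P) :
    letI := flagCharted hP
    IsSmoothManifold (strictLower P) (MulAction.orbit Aˣ (flag hP.tuple)) := by
  let := flagCharted hP
  refine ⟨t2Space_orbit _, ?_⟩
  rintro _ ⟨h, rfl⟩ _ ⟨h', rfl⟩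
  exact isSmoothOn_flagChart_comp hP h' (OpenPartialHomeomorph.open_source _) (fun x hx => hx.2)
    (fun x => h * unipotent hP x.1 x.2) (fun _ _ => rfl) fun k => isSlopeCk_val_unipotent hP h k _

theorem isSmoothMap_orbitMap (hP : IsCommutingChain n P) :
    letI := flagCharted hP
    IsSmoothMap A (strictLower P) (orbitMap (flag hP.tuple)) := by
  let := flagCharted hP
  refine ⟨continuous_orbitMap _, ?_⟩
  rintro e he _ ⟨h, rfl⟩
  have hU : IsOpen (e.target ∩
      e.symm ⁻¹' (orbitMap (flag hP.tuple) ⁻¹' (flagChart hP h).source)) :=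
    e.isOpen_inter_preimage_symm ((flagChart hP h).open_source.preimage (continuous_orbitMap _))
  refine isSmoothOn_flagChart_comp hP h hU (fun x hx => hx.2) e.symm (fun _ _ => rfl) fun k => ?_
  exact (IsSlopeCk.clm k (.id ℝ A) _).congr fun a ha => val_of_mem_atlas_units he ha.1

theorem isSmoothMap_action (hP : IsCommutingChain n P) :
    letI := flagCharted hP
    IsSmoothMap (A × strictLower P) (strictLower P)
      (fun x : Aˣ × MulAction.orbit Aˣ (flag hP.tuple) => x.1 • x.2) := by
  let := flagCharted hP
  refine ⟨continuous_action _, ?_⟩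
  rintro _ ⟨e, he, _, ⟨h, rfl⟩, rfl⟩ _ ⟨h', rfl⟩
  refine isSmoothOn_flagChart_comp hP h' (OpenPartialHomeomorph.isOpen_inter_preimage_symm _
    ((flagChart hP h').open_source.preimage (continuous_action _))) (fun x hx => hx.2)
    (fun x => e.symm x.1 * (h * unipotent hP x.2.1 x.2.2))
    (fun x _ => Subtype.ext (mul_smul (e.symm x.1) (h * unipotent hP x.2.1 x.2.2) _).symm)
    fun k => ?_
  refine IsSlopeCk.mul ?_ (IsSlopeCk.comp_clm (isSlopeCk_val_unipotent hP h k Set.univ)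
    (ContinuousLinearMap.snd ℝ A (strictLower P)) fun _ _ => Set.mem_univ _)
  exact (IsSlopeCk.clm k (ContinuousLinearMap.fst ℝ A (strictLower P)) _).congr fun x hx =>
    val_of_mem_atlas_units he hx.1.1

end Chart

end FlagManifold

open LCManifold FlagManifold in
theorem theorem4p3 (A : Type u) [Ring A] [Algebra ℂ A] [TopologicalSpace A]
    [ContinuousInverseAlgebra A] (n : ℕ) (hn : 1 ≤ n) :
    (∀ δ : FlagTuple A n,
      (∃ φ : (Aˣ ⧸ upperUnits δ) ≃ₜ MulAction.orbit Aˣ (flag δ),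
        ∀ g : Aˣ, φ (g : Aˣ ⧸ upperUnits δ) = orbitMap (flag δ) g) ∧
      ∃ (E : Type u) (_ : AddCommGroup E) (_ : Module ℝ E) (_ : TopologicalSpace E)
        (_ : IsTopologicalAddGroup E) (_ : ContinuousSMul ℝ E) (_ : LocallyConvexSpace ℝ E)
        (_ : T2Space E) (_ : ChartedSpace E (MulAction.orbit Aˣ (flag δ))),
        IsSmoothManifold E (MulAction.orbit Aˣ (flag δ)) ∧
        IsSmoothMap (A × E) E
          (fun x : Aˣ × MulAction.orbit Aˣ (flag δ) => x.1 • x.2) ∧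
        IsSmoothMap A E (orbitMap (flag δ)) ∧
        IsOpenMap (orbitMap (flag δ))) ∧
    Function.Injective (toGr : Fl A n → Fin n → Gr A) ∧
    Continuous (toGr : Fl A n → Fin n → Gr A) := by
  refine ⟨fun δ => ⟨exists_homeomorph_orbit δ, ?_⟩, injective_toGr, continuous_toGr⟩
  obtain ⟨P, hP, hX⟩ := exists_isCommutingChain (flag δ)
  rw [← hX]
  exact ⟨strictLower P, inferInstance, inferInstance, inferInstance, inferInstance, inferInstance,
    inferInstance, inferInstance, flagCharted hP, isSmoothManifold_orbit hP, isSmoothMap_action hP,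
    isSmoothMap_orbitMap hP, isOpenMap_orbitMap _⟩
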